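/- **Definitions.** A *reproducing kernel* on a set $A$ is a symmetric function $K:A\times A\to\mathbb R$ with $\sum_{i,j}\alpha_i\alpha_jK(x_i,x_j)\ge 0$ for all finite families $x_i\in A$, $\alpha_i\in\mathbb R$; $\mathcal H(K)$ is its reproducing kernel Hilbert space. Let $X=[0,1]$. A *regular domain* is a set $\Omega=\bigcup_{t\in T}(I_t\times I_t)\subset X\times X$, where $T=[0,t_0]$ with $0<t_0<1$, $I_t=[t,b(t)]$, and $b:T\to\mathbb R$ is strictly increasing and left-continuous, with $b(t)>t$ for all $t\in T$ and $b(t_0)=1$. A function $K_\Omega:\Omega\to\mathbb R$ is a *partially reproducing kernel* if $K_\Omega|_{A\times A}$ is a reproducing kernel on $A$ for every $A\subset X$ with $A\times A\subset\Omega$. A *completion* of $K_\Omega$ is a reproducing kernel $\tilde K$ on $X$ with $\tilde K|_\Omega=K_\Omega$. A set $S\subset X$ *separates* $x,y\in X\setminus S$ in $\Omega$ if every finite path $x=z_0,z_1,\dots,z_{n+1}=y$ in $X$ with $(z_k,z_{k+1})\in\Omega$ for $0\le k\le n$ has some $z_k\in S$ with $1\le k\le n$. A completion $\tilde K$ is *canonical*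 if $$\tilde K(x,y)=\langle \tilde K(x,\cdot)|_S,\tilde K(y,\cdot)|_S\rangle_{\mathcal H(\tilde K|_{S\times S})}\quad\text{whenever } S \text{ separates } x \text{ and } y \text{ in } \Omega .$$ For $t\in T$ put $K_{I_t}=K_\Omega|_{I_t\times I_t}$, and for $u\in I_t$ let $k_{u,I_t}\in\mathcal H(K_{I_t})$ be the function $w\mapsto K_\Omega(u,w)$. A *canonical semigroupoid* of $K_\Omega$ is a family of linear contractions $\Phi_{xy}:\mathcal H(K_{I_y})\to\mathcal H(K_{I_x})$, for $x,y\in T$ with $x\ge y$, such that $\Phi_{xz}=\Phi_{xy}\Phi_{yz}$ for $x\ge y\ge z$ and $\Phi_{xy}k_{z,I_y}=k_{z,I_x}$ for $z\in I_x\cap I_y$. For $x<y$ write $\Phi_{xy}=\Phi_{yx}^*$. **Theorem.** Let $\Omega$ be a regular domain and let $K_\Omega:\Omega\to\mathbb R$ be a continuous partially reproducing kernel. Then the relation $$\tilde K(x,y)=\langle\Phi_{ts}k_{x,I_s},k_{y,I_t}\rangle\qquad\text{for all } s,t\in T,\ x\in I_s,\ y\in I_t$$ is the graph of a bijection between the canonical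 completions $\tilde K$ of $K_\Omega$ and the canonical semigroupoids $\{\Phi_{xy}\}_{x\ge y}$ of $K_\Omega$. -/

import Mathlib

open Set
open scoped unitInterval InnerProductSpace

noncomputable section

namespace KernelCompletion

universe u

/-! ### Reproducing kernels and their Hilbert spaces -/

/-- A real function of two variables is a reproducing kernel if it is symmetric and
positive semidefinite. -/
def IsReproducingKernel {X : Type u} (K : X → X → ℝ) : Prop :=
  (∀ x y, K x y = K y x) ∧
    ∀ (n : ℕ) (x : Fin n → X) (α : Fin n → ℝ),
      0 ≤ ∑ i, ∑ j, α i * α j * K (x i) (x j)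

/-- A reproducing kernel on `X`, bundled. -/
structure ReproducingKernel (X : Type u) where
  toFun : X → X → ℝ
  isKernel : IsReproducingKernel toFun

instance {X : Type u} : CoeFun (ReproducingKernel X) (fun _ => X → X → ℝ) :=
  ⟨ReproducingKernel.toFun⟩

namespace ReproducingKernel

variable {X : Type u}

/-- The kernel as a matrix of operators on the one-dimensional space `ℝ`, which is the form in which
Mathlib takes the kernel of a space of scalar functions. -/
def opMatrix (K : ReproducingKernel X) : Matrix X X (ℝ →L[ℝ] ℝ) :=
  fun x y => K x y • ContinuousLinearMap.id ℝ ℝ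

theorem posSemidef_opMatrix (K : ReproducingKernel X) : K.opMatrix.PosSemidef := by
  have t := (RKHS.posSemidef_tfae (K := K.opMatrix)).out 0 2
  refine t.mpr ⟨?_, fun v => ?_⟩
  · ext x y
    have hs : star (ContinuousLinearMap.id ℝ ℝ) = ContinuousLinearMap.id ℝ ℝ :=
      star_one (ℝ →L[ℝ] ℝ)
    simp [hs, opMatrix, Matrix.conjTranspose_apply, K.isKernel.1 x y]
  · have h := K.isKernel.2 v.support.card (fun i => (v.support.equivFin.symm i : X))
      (fun i => v (v.support.equivFin.symm i : X))
    have key : ∀ F : X → ℝ, ∑ i, F (v.support.equivFin.symm i : X) = ∑ x ∈ v.support, F x := by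
      intro F
      rw [Equiv.sum_comp v.support.equivFin.symm (fun z : v.support => F z),
        Finset.sum_coe_sort v.support F]
    rw [key (fun x => ∑ j, v x * v (v.support.equivFin.symm j : X) *
      K x (v.support.equivFin.symm j : X))] at h
    have h' : 0 ≤ ∑ x ∈ v.support, ∑ y ∈ v.support, v x * v y * K x y := by
      refine h.trans_eq (Finset.sum_congr rfl fun x _ => ?_)
      exact key (fun y => v x * v y * K x y)
    refine h'.trans_eq ?_
    simp only [Finsupp.sum, opMatrix, RCLike.re_to_real]
    refine Finset.sum_congr rfl fun x _ => Finset.sum_congr rfl fun y _ => ?_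
    simp [K.isKernel.1 y x]
    ring

instance (K : ReproducingKernel X) : Fact K.opMatrix.PosSemidef := ⟨K.posSemidef_opMatrix⟩

/-- The reproducing kernel Hilbert space `H(K)`; its elements are functions on `X` through the
coercion provided by `RKHS`. -/
abbrev H (K : ReproducingKernel X) : Type u := RKHS.OfKernel K.opMatrix

/-- The generator `k_x ∈ H(K)`. -/
def gen (K : ReproducingKernel X) (x : X) : K.H := RKHS.kerFun K.H x (1 : ℝ)

theorem gen_apply (K : ReproducingKernel X) (x y : X) : K.gen x y = K x y := by
  rw [gen, RKHS.kerFun_apply, RKHS.OfKernel.kernel_ofKernel]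
  simp [opMatrix, K.isKernel.1 y x]

theorem inner_gen_right (K : ReproducingKernel X) (f : K.H) (x : X) : ⟪f, K.gen x⟫_ℝ = f x := by
  simp [gen]

theorem inner_gen_gen (K : ReproducingKernel X) (x y : X) :
    ⟪K.gen x, K.gen y⟫_ℝ = K x y := by
  rw [inner_gen_right, gen_apply]

/-- The subkernel `K_S = K|_{S × S}`. -/
def restrict (K : ReproducingKernel X) (S : Set X) : ReproducingKernel S where
  toFun x y := K x y
  isKernel := ⟨fun x y => K.isKernel.1 x y, fun n x α => K.isKernel.2 n (fun i => x i) α⟩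

end ReproducingKernel

/-! ### Domains, partially reproducing kernels and completions -/

section Completion

variable {X : Type u} {Ω : Set (X × X)}

/-- The restriction of a function on `Ω` to `A × A`, where `A` is a clique of `Ω`. -/
def cliqueRestrict (KΩ : Ω → ℝ) {A : Set X} (hA : A ×ˢ A ⊆ Ω) (x y : A) : ℝ :=
  KΩ ⟨((x : X), (y : X)), hA ⟨x.2, y.2⟩⟩

/-- `KΩ` is a partially reproducing kernel: its restriction to `A × A` is a reproducing kernel for
every `A` with `A × A ⊆ Ω`. -/
def IsPartiallyReproducing (KΩ : Ω → ℝ) : Prop :=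
  ∀ (A : Set X) (hA : A ×ˢ A ⊆ Ω), IsReproducingKernel (cliqueRestrict KΩ hA)

/-- `K` is a completion of `KΩ`: a reproducing kernel on `X` that extends `KΩ`. -/
def IsCompletion (KΩ : Ω → ℝ) (K : ReproducingKernel X) : Prop :=
  ∀ p : Ω, K p.1.1 p.1.2 = KΩ p

/-- `S` separates the points `x` and `y` outside `S` in the graph `(X, Ω)`: every path
`x = z 0, z 1, …, z (n + 1) = y` passes through `S`. -/
def Separates (Ω : Set (X × X)) (S : Set X) (x y : X) : Prop :=
  x ∉ S ∧ y ∉ S ∧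
    ∀ (n : ℕ) (z : ℕ → X), z 0 = x → z (n + 1) = y →
      (∀ k ≤ n, (z k, z (k + 1)) ∈ Ω) → ∃ k, 1 ≤ k ∧ k ≤ n ∧ z k ∈ S

/-- `K` is a canonical completion of `KΩ`: it is a completion and
`K(x, y) = ⟨k_{x,S}, k_{y,S}⟩` in `H(K_S)` whenever `S` separates `x` and `y`. Here `f = k_{x,S}` is
the element of `H(K_S)` given by the function `v ↦ K(x, v)` on `S`, and likewise `g = k_{y,S}`; an
element of `H(K_S)` is determined by its values. -/
def IsCanonicalCompletion (KΩ : Ω → ℝ) (K : ReproducingKernel X) : Prop :=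
  IsCompletion KΩ K ∧
    ∀ (S : Set X) (x y : X), Separates Ω S x y →
      ∃ f g : (K.restrict S).H,
        (∀ v : S, f v = K x v) ∧ (∀ v : S, g v = K y v) ∧ K x y = ⟪f, g⟫_ℝ

end Completion

/-! ### Regular domains -/

/-- The data of a regular domain on `X = [0, 1]`: the parameter set is `T = [0, t₀]` with
`0 < t₀ < 1`, and `b` is the strictly increasing, left-continuous function on `T` that gives the
right end points of the intervals `I_t = [t, b(t)]`. -/
structure RegularDomain where
  t₀ : ℝ
  t₀_pos : 0 < t₀
  t₀_lt_one : t₀ < 1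
  b : Icc (0 : ℝ) t₀ → ℝ
  strictMono_b : StrictMono b
  leftContinuous_b : ∀ t, ContinuousWithinAt b (Iic t) t
  lt_b : ∀ t : Icc (0 : ℝ) t₀, (t : ℝ) < b t
  b_last : b ⟨t₀, t₀_pos.le, le_rfl⟩ = 1

namespace RegularDomain

/-- The parameter set `T = [0, t₀]`. -/
abbrev T (D : RegularDomain) : Type := Icc (0 : ℝ) D.t₀

/-- The interval `I_t = [t, b(t)]`, as a subset of `[0, 1]`. -/
def window (D : RegularDomain) (t : D.T) : Set I := {x | (t : ℝ) ≤ x ∧ (x : ℝ) ≤ D.b t}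

/-- The domain `Ω = ⋃_{t ∈ T} I_t × I_t`. -/
def edges (D : RegularDomain) : Set (I × I) := ⋃ t : D.T, D.window t ×ˢ D.window t

theorem window_clique (D : RegularDomain) (t : D.T) : D.window t ×ˢ D.window t ⊆ D.edges :=
  subset_iUnion (fun t : D.T => D.window t ×ˢ D.window t) t

end RegularDomain

/-! ### Canonical semigroupoids -/

section Semigroupoid

variable (D : RegularDomain) {KΩ : D.edges → ℝ} (hK : IsPartiallyReproducing KΩ)

/-- The kernel `K_{I_t}`, the restriction of `KΩ` to `I_t × I_t`. -/
def windowKernel (t : D.T) : ReproducingKernel (D.window t) :=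
  ⟨cliqueRestrict KΩ (D.window_clique t), hK _ (D.window_clique t)⟩

/-- Families `Φ` of bounded linear maps `Φ_{xy} : H(K_{I_y}) → H(K_{I_x})`, indexed by `x ≥ y`
in `T`. -/
abbrev OperatorFamily : Type :=
  ∀ x y : D.T, y ≤ x → ((windowKernel D hK y).H →L[ℝ] (windowKernel D hK x).H)

/-- `Φ` is a canonical semigroupoid of `KΩ`. -/
structure IsCanonicalSemigroupoid (Φ : OperatorFamily D hK) : Prop where
  contraction : ∀ (x y : D.T) (h : y ≤ x), ‖Φ x y h‖ ≤ 1
  comp : ∀ (x y z : D.T) (hyx : y ≤ x) (hzy : z ≤ y),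
    Φ x z (hzy.trans hyx) = (Φ x y hyx).comp (Φ y z hzy)
  map_gen : ∀ (x y : D.T) (h : y ≤ x) (z : I) (hx : z ∈ D.window x) (hy : z ∈ D.window y),
    Φ x y h ((windowKernel D hK y).gen ⟨z, hy⟩) = (windowKernel D hK x).gen ⟨z, hx⟩

/-- The relation `K(x, y) = ⟨Φ_{ts} k_{x,I_s}, k_{y,I_t}⟩` for all `x ∈ I_s` and `y ∈ I_t`, where
`Φ_{ts}` stands for the adjoint of `Φ_{st}` if `t ≤ s`. -/
def Represents (Φ : OperatorFamily D hK) (K : ReproducingKernel I) : Prop :=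
  ∀ (s t : D.T) (x y : I) (hx : x ∈ D.window s) (hy : y ∈ D.window t),
    (∀ h : s ≤ t, K x y =
      ⟪Φ t s h ((windowKernel D hK s).gen ⟨x, hx⟩), (windowKernel D hK t).gen ⟨y, hy⟩⟫_ℝ) ∧
    (∀ h : t ≤ s, K x y =
      ⟪(Φ s t h).adjoint ((windowKernel D hK s).gen ⟨x, hx⟩),
        (windowKernel D hK t).gen ⟨y, hy⟩⟫_ℝ)

end Semigroupoid

end KernelCompletion

end

/-! Let `K` be a completion and let `V_t : H(K_{I_t}) → H(K)` be the isometry that sends generators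
to generators. Its range is the closed span of the `k_u` with `u ∈ I_t`. The relation in the theorem
reads `⟨Φ_{ts} k_x, k_y⟩ = ⟨V_s k_x, V_t k_y⟩`, so it forces `Φ_{ts} = V_t^* V_s`. Conversely the
windows cover `[0, 1]`, so `Φ` determines `K`. What remains is that canonical completions yield
semigroupoids and that every semigroupoid comes from a canonical completion.

Since `V_y V_y^*` is the projection `P_y` onto the range of `V_y`, the law `Φ_{xz} = Φ_{xy} Φ_{yz}`
is the Markov property `K(u, v) = ⟨P_y k_u, k_v⟩` for `u ∈ I_z`, `v ∈ I_x`
(`transferFamily_comp_iff`). A canonical `K` has this property because a window separates its left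
side from its right side (`separates_window`).

Given `Φ`, define `K` by transporting `k_x` to the last window of the larger point. Positivity
follows by adding points in increasing order and using that each `Φ` is a contraction
(`norm_sum_push_sq_le`). The composition law gives the Markov property for windows, which extends to
any `S` separating `x < y`: such an `S` contains the interior of some window between them
(`Separates.exists_window`), by continuity the span of `S` contains all generators of that window,
and the projection onto the span of `S` commutes with the projection onto the past of the window
(`proj_comm_of_mem`). -/

open Set
open scoped unitInterval InnerProductSpace
noncomputable section

namespace KernelCompletion
universe u

/-! ### Generators, subkernels and orthogonal projections in `H(K)` -/

namespace ReproducingKernel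

variable {X : Type u}

theorem dense_span_gen (K : ReproducingKernel X) :
    (Submodule.span ℝ (range K.gen)).topologicalClosure = ⊤ := by
  rw [eq_top_iff, ← RKHS.kerFun_dense K.H]
  refine Submodule.topologicalClosure_mono (Submodule.span_le.mpr ?_)
  rintro _ ⟨x, v, rfl⟩
  have : RKHS.kerFun K.H x v = v • K.gen x := by
    rw [gen, ← map_smul, smul_eq_mul, mul_one]
  rw [this]
  exact Submodule.smul_mem _ _ (Submodule.subset_span ⟨x, rfl⟩)

theorem denseRange_linearCombination_gen (K : ReproducingKernel X) :
    DenseRange (Finsupp.linearCombination ℝ K.gen) := by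
  have h := K.dense_span_gen
  rw [← Finsupp.range_linearCombination, ← Submodule.dense_iff_topologicalClosure_eq_top] at h
  exact h

theorem ext_gen {K : ReproducingKernel X} {E : Type*} [NormedAddCommGroup E] [NormedSpace ℝ E]
    {A B : K.H →L[ℝ] E} (h : ∀ x, A (K.gen x) = B (K.gen x)) : A = B := by
  have hd : Dense (Submodule.span ℝ (range K.gen) : Set K.H) :=
    Submodule.dense_iff_topologicalClosure_eq_top.mpr K.dense_span_gen
  exact ContinuousLinearMap.ext_on hd (by rintro _ ⟨x, rfl⟩; exact h x)

theorem ext_inner_gen {K : ReproducingKernel X} {f g : K.H}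
    (h : ∀ x, ⟪f, K.gen x⟫_ℝ = ⟪g, K.gen x⟫_ℝ) : f = g := by
  ext x
  simpa only [inner_gen_right] using h x

theorem inner_linearCombination_gen {E : Type*} [NormedAddCommGroup E] [InnerProductSpace ℝ E]
    (g : X → E) (c : X →₀ ℝ) :
    ⟪Finsupp.linearCombination ℝ g c, Finsupp.linearCombination ℝ g c⟫_ℝ =
      c.sum fun x a => c.sum fun y b => a * b * ⟪g x, g y⟫_ℝ := by
  simp only [Finsupp.linearCombination_apply, Finsupp.sum, sum_inner, inner_sum,
    real_inner_smul_left, real_inner_smul_right, mul_assoc]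
  refine Finset.sum_congr rfl fun x _ => Finset.sum_congr rfl fun y _ => ?_
  rw [real_inner_comm]

/-- Both squared norms are the same quadratic form in the kernel values. This is what makes `embed`
well defined and isometric on a dense subspace. -/
theorem norm_linearCombination_gen_eq {S : Set X} {K : ReproducingKernel X}
    {L : ReproducingKernel S} (h : ∀ u v : S, L u v = K u v) (c : S →₀ ℝ) :
    ‖Finsupp.linearCombination ℝ (fun u : S => K.gen u) c‖ =
      ‖Finsupp.linearCombination ℝ L.gen c‖ := by
  rw [← sq_eq_sq₀ (norm_nonneg _) (norm_nonneg _), ← real_inner_self_eq_norm_sq,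
    ← real_inner_self_eq_norm_sq, inner_linearCombination_gen, inner_linearCombination_gen]
  simp only [inner_gen_gen, h]

/-- The isometric embedding of the space of a subkernel that maps generators to generators. -/
def embed {S : Set X} (K : ReproducingKernel X) (L : ReproducingKernel S)
    (h : ∀ u v : S, L u v = K u v) : L.H →ₗᵢ[ℝ] K.H where
  toLinearMap := ((Finsupp.linearCombination ℝ (fun u : S => K.gen u)).extendOfNorm
    (Finsupp.linearCombination ℝ L.gen)).toLinearMap
  norm_map' f := by
    have hb : ∃ C, ∀ c, ‖Finsupp.linearCombination ℝ (fun u : S => K.gen u) c‖ ≤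
        C * ‖Finsupp.linearCombination ℝ L.gen c‖ :=
      ⟨1, fun c => by rw [norm_linearCombination_gen_eq h, one_mul]⟩
    refine L.denseRange_linearCombination_gen.induction_on (p := fun f =>
      ‖((Finsupp.linearCombination ℝ (fun u : S => K.gen u)).extendOfNorm
        (Finsupp.linearCombination ℝ L.gen)) f‖ = ‖f‖) f
      (isClosed_eq (by fun_prop) (by fun_prop)) fun c => ?_
    rw [LinearMap.extendOfNorm_eq L.denseRange_linearCombination_gen hb,
      norm_linearCombination_gen_eq h]

section Embed

variable {S : Set X} {K : ReproducingKernel X} {L : ReproducingKernel S}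
  (h : ∀ u v : S, L u v = K u v)

theorem embed_gen (u : S) : K.embed L h (L.gen u) = K.gen u := by
  have hb : ∃ C, ∀ c, ‖Finsupp.linearCombination ℝ (fun u : S => K.gen u) c‖ ≤
      C * ‖Finsupp.linearCombination ℝ L.gen c‖ :=
    ⟨1, fun c => by rw [norm_linearCombination_gen_eq h, one_mul]⟩
  have := LinearMap.extendOfNorm_eq L.denseRange_linearCombination_gen hb (Finsupp.single u 1)
  simpa using! this

/-- The adjoint of `embed`, which restricts functions to the subset. -/
def restrictMap : K.H →L[ℝ] L.H := (K.embed L h).toContinuousLinearMap.adjoint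

theorem restrictMap_inner_left (a : K.H) (f : L.H) :
    ⟪restrictMap h a, f⟫_ℝ = ⟪a, K.embed L h f⟫_ℝ := by
  rw [restrictMap, ContinuousLinearMap.adjoint_inner_left]; rfl

theorem restrictMap_apply (a : K.H) (u : S) : restrictMap h a u = ⟪a, K.gen u⟫_ℝ := by
  rw [← inner_gen_right, restrictMap_inner_left, embed_gen]

theorem norm_restrictMap_le : ‖restrictMap h‖ ≤ 1 := by
  rw [restrictMap, LinearIsometryEquiv.norm_map]
  exact LinearIsometry.norm_toContinuousLinearMap_le _

end Embed

/-- The closed span of the generators with index in `A`. -/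
def closedSpan (K : ReproducingKernel X) (A : Set X) : Submodule ℝ K.H :=
  (Submodule.span ℝ (K.gen '' A)).topologicalClosure

theorem isClosed_closedSpan (K : ReproducingKernel X) (A : Set X) :
    IsClosed (K.closedSpan A : Set K.H) :=
  Submodule.isClosed_topologicalClosure _

instance (K : ReproducingKernel X) (A : Set X) : (K.closedSpan A).HasOrthogonalProjection :=
  haveI : CompleteSpace (K.closedSpan A) := (K.isClosed_closedSpan A).completeSpace_coe
  inferInstance

theorem gen_mem_closedSpan (K : ReproducingKernel X) {A : Set X} {x : X} (hx : x ∈ A) :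
    K.gen x ∈ K.closedSpan A :=
  Submodule.le_topologicalClosure _ (Submodule.subset_span ⟨x, hx, rfl⟩)

theorem closedSpan_le {K : ReproducingKernel X} {A : Set X} {M : Submodule ℝ K.H}
    (hM : IsClosed (M : Set K.H)) (h : ∀ x ∈ A, K.gen x ∈ M) : K.closedSpan A ≤ M :=
  Submodule.topologicalClosure_minimal _
    (Submodule.span_le.mpr (by rintro _ ⟨x, hx, rfl⟩; exact h x hx)) hM

/-- The orthogonal projection to `closedSpan K A`. -/
def proj (K : ReproducingKernel X) (A : Set X) : K.H →L[ℝ] K.H := (K.closedSpan A).starProjection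

theorem proj_mem (K : ReproducingKernel X) (A : Set X) (a : K.H) : K.proj A a ∈ K.closedSpan A :=
  Submodule.starProjection_apply_mem _ _

theorem proj_of_mem (K : ReproducingKernel X) {A : Set X} {a : K.H} (h : a ∈ K.closedSpan A) :
    K.proj A a = a :=
  Submodule.starProjection_eq_self_iff.mpr h

theorem proj_gen (K : ReproducingKernel X) {A : Set X} {x : X} (hx : x ∈ A) :
    K.proj A (K.gen x) = K.gen x :=
  K.proj_of_mem (K.gen_mem_closedSpan hx)

theorem inner_proj (K : ReproducingKernel X) (A : Set X) (a b : K.H) :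
    ⟪K.proj A a, b⟫_ℝ = ⟪a, K.proj A b⟫_ℝ :=
  Submodule.inner_starProjection_left_eq_right _ _ _

/-- The vectors orthogonal to `a - p` form a closed subspace, so orthogonality to the closed span
need only be tested on generators. -/
theorem eq_proj {K : ReproducingKernel X} {A : Set X} {a p : K.H} (hp : p ∈ K.closedSpan A)
    (h : ∀ x ∈ A, ⟪p, K.gen x⟫_ℝ = ⟪a, K.gen x⟫_ℝ) : K.proj A a = p := by
  refine (Submodule.eq_starProjection_of_mem_of_inner_eq_zero hp fun w hw => ?_)
  have hc : IsClosed (LinearMap.ker (innerSL ℝ (a - p)).toLinearMap : Set K.H) :=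
    ContinuousLinearMap.isClosed_ker (innerSL ℝ (a - p))
  have := closedSpan_le hc (fun x hx => ?_) hw
  · simpa [inner_sub_left] using! this
  · simp [h x hx]

/-- For an isometry `V`, the operator `V V^*` is the projection onto the range of `V`. -/
theorem proj_eq_embed_restrictMap {S : Set X} {K : ReproducingKernel X} {L : ReproducingKernel S}
    (h : ∀ u v : S, L u v = K u v) (a : K.H) :
    K.proj S a = K.embed L h (restrictMap h a) := by
  refine eq_proj ?_ fun x hx => ?_
  · refine L.denseRange_linearCombination_gen.induction_on (p := fun f =>
      K.embed L h f ∈ K.closedSpan S) _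
      ((K.isClosed_closedSpan S).preimage (K.embed L h).continuous) fun c => ?_
    rw [Finsupp.linearCombination_apply, Finsupp.sum, map_sum]
    refine Submodule.sum_mem _ fun u _ => ?_
    rw [map_smul, embed_gen]
    exact Submodule.smul_mem _ _ (K.gen_mem_closedSpan u.2)
  · have e := embed_gen h ⟨x, hx⟩
    rw [← e, LinearIsometry.inner_map_map, restrictMap_inner_left]

/-- The inner product of the restrictions to `S` of two elements of `H(K)`. -/
theorem inner_restrictMap {S : Set X} {K : ReproducingKernel X} {L : ReproducingKernel S}
    (h : ∀ u v : S, L u v = K u v) (a b : K.H) :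
    ⟪restrictMap h a, restrictMap h b⟫_ℝ = ⟪K.proj S a, b⟫_ℝ := by
  rw [proj_eq_embed_restrictMap h, real_inner_comm, restrictMap_inner_left, real_inner_comm]

theorem eq_restrictMap {S : Set X} {K : ReproducingKernel X} {L : ReproducingKernel S}
    (h : ∀ u v : S, L u v = K u v) {a : K.H} {f : L.H} (hf : ∀ u : S, f u = ⟪a, K.gen u⟫_ℝ) :
    f = restrictMap h a := by
  ext u
  rw [hf, restrictMap_apply]

end ReproducingKernel

/-- The canonicity condition in terms of orthogonal projections in `H(K)`. -/
theorem isCanonicalCompletion_iff {X : Type u} {Ω : Set (X × X)} {KΩ : Ω → ℝ}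
    {K : ReproducingKernel X} :
    IsCanonicalCompletion KΩ K ↔ IsCompletion KΩ K ∧
      ∀ (S : Set X) (x y : X), Separates Ω S x y →
        K x y = ⟪K.proj S (K.gen x), K.gen y⟫_ℝ := by
  have hr (S : Set X) : ∀ u v : S, K.restrict S u v = K u v := fun _ _ => rfl
  refine and_congr_right fun _ => forall₄_congr fun S x y _ => ⟨?_, fun h => ?_⟩
  · rintro ⟨f, g, hf, hg, h⟩
    rw [h, ReproducingKernel.eq_restrictMap (hr S) (a := K.gen x) (f := f)
      fun u => by rw [hf, ReproducingKernel.inner_gen_gen],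
      ReproducingKernel.eq_restrictMap (hr S) (a := K.gen y) (f := g)
      fun u => by rw [hg, ReproducingKernel.inner_gen_gen], ReproducingKernel.inner_restrictMap]
  · refine ⟨ReproducingKernel.restrictMap (hr S) (K.gen x),
      ReproducingKernel.restrictMap (hr S) (K.gen y), fun v => ?_, fun v => ?_, ?_⟩
    · rw [ReproducingKernel.restrictMap_apply, ReproducingKernel.inner_gen_gen]
    · rw [ReproducingKernel.restrictMap_apply, ReproducingKernel.inner_gen_gen]
    · rw [ReproducingKernel.inner_restrictMap, h]

end KernelCompletion
end

/-! ### Windows of a regular domain and separation -/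

noncomputable section

namespace KernelCompletion

namespace RegularDomain

variable (D : RegularDomain)

theorem b_le_one (t : D.T) : D.b t ≤ 1 := by
  rw [← D.b_last]
  exact D.strictMono_b.monotone t.2.2

/-- The largest parameter whose window contains `x`. -/
def tau (x : I) : D.T := ⟨min x D.t₀, le_min x.2.1 D.t₀_pos.le, min_le_right _ _⟩

theorem tau_mono {x y : I} (h : x ≤ y) : D.tau x ≤ D.tau y :=
  Subtype.coe_le_coe.mp (min_le_min_right D.t₀ (Subtype.coe_le_coe.mpr h))

variable {D}

theorem le_tau {x : I} {t : D.T} (h : (t : ℝ) ≤ x) : t ≤ D.tau x :=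
  Subtype.coe_le_coe.mp (le_min h t.2.2)

theorem tau_le (x : I) : (D.tau x : ℝ) ≤ x := min_le_left _ _

theorem b_tau_of_le {x : I} (h : D.t₀ ≤ x) : D.b (D.tau x) = 1 := by
  have : D.tau x = ⟨D.t₀, D.t₀_pos.le, le_rfl⟩ := Subtype.ext (min_eq_right h)
  rw [this, D.b_last]

theorem le_b_tau (x : I) : (x : ℝ) ≤ D.b (D.tau x) := by
  rcases le_total (x : ℝ) D.t₀ with h | h
  · have : (D.tau x : ℝ) = x := min_eq_left h
    exact this ▸ (D.lt_b _).le
  · rw [b_tau_of_le h]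
    exact x.2.2

theorem mem_window_tau (x : I) : x ∈ D.window (D.tau x) := ⟨tau_le x, le_b_tau x⟩

/-- A point of two windows belongs to the windows in between. -/
theorem mem_window_of_mem_of_mem {x : I} {r s t : D.T} (hrs : r ≤ s) (hst : s ≤ t)
    (hr : x ∈ D.window r) (ht : x ∈ D.window t) : x ∈ D.window s :=
  ⟨(Subtype.coe_le_coe.mpr hst).trans ht.1, hr.2.trans (D.strictMono_b.monotone hrs)⟩

theorem mem_edges_of_le {x y : I} (hxy : x ≤ y) (hy : (y : ℝ) ≤ D.b (D.tau x)) :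
    (x, y) ∈ D.edges :=
  D.window_clique (D.tau x) ⟨mem_window_tau x, (tau_le x).trans (Subtype.coe_le_coe.mpr hxy), hy⟩

theorem edges_symm {x y : I} (h : (x, y) ∈ D.edges) : (y, x) ∈ D.edges := by
  obtain ⟨t, ht⟩ := mem_iUnion.mp h
  exact D.window_clique t ⟨ht.2, ht.1⟩

/-- A window separates the points on its left from the points on its right. -/
theorem separates_window {t : D.T} {x y : I} (hx : (x : ℝ) < t) (hy : D.b t < y) :
    Separates D.edges (D.window t) x y := by
  refine ⟨fun h => h.1.not_gt hx, fun h => h.2.not_gt hy, fun n z h0 hn hz => ?_⟩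
  by_contra! hc
  -- A path that avoids `I_t` cannot leave the left side: an edge from a point below `t` lies in
  -- some `I_r` with `r < t`, so its end is at most `b(r) < b(t)`, and is therefore either below `t`
  -- or in `I_t`.
  have key : ∀ k ≤ n, (z k : ℝ) < t := by
    intro k
    induction k with
    | zero => intro _; rwa [h0]
    | succ k ih =>
      intro hk
      obtain ⟨r, hr⟩ := mem_iUnion.mp (hz k (by omega))
      have hrt : r < t := Subtype.coe_lt_coe.mp (hr.1.1.trans_lt (ih (by omega)))
      by_contra! hge
      exact hc (k + 1) (by omega) hk ⟨hge, hr.2.2.trans (D.strictMono_b hrt).le⟩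
  obtain ⟨r, hr⟩ := mem_iUnion.mp (hz n le_rfl)
  have hrt : r < t := Subtype.coe_lt_coe.mp (hr.1.1.trans_lt (key n le_rfl))
  have := hr.2.2.trans (D.strictMono_b hrt).le
  simp only [hn] at this
  exact this.not_gt hy

end RegularDomain

theorem Separates.symm {D : RegularDomain} {S : Set I} {x y : I}
    (h : Separates D.edges S x y) : Separates D.edges S y x := by
  refine ⟨h.2.1, h.1, fun n z h0 hn hz => ?_⟩
  obtain ⟨k, hk1, hkn, hk⟩ := h.2.2 n (fun k => z (n + 1 - k)) (by simpa using hn)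
    (by simpa using h0) fun k hk => by
      have := RegularDomain.edges_symm (hz (n - k) (by omega))
      rwa [show n - k + 1 = n + 1 - k by omega, show n - k = n + 1 - (k + 1) by omega] at this
  exact ⟨n + 1 - k, by omega, by omega, hk⟩

/-! ### From completions to operator families -/

section Family

open ReproducingKernel

variable {D : RegularDomain} {KΩ : D.edges → ℝ} {hK : IsPartiallyReproducing KΩ}
  {K : ReproducingKernel I}

theorem IsCompletion.windowKernel_eq (hc : IsCompletion KΩ K) (hK : IsPartiallyReproducing KΩ)
    (t : D.T) (u v : D.window t) : windowKernel D hK t u v = K u v :=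
  (hc ⟨((u : I), (v : I)), D.window_clique t ⟨u.2, v.2⟩⟩).symm

/-- The operators `Φ_{st} = V_s^* V_t`, where `V_t` is the embedding of `H(K_{I_t})`. -/
def transferFamily (hc : IsCompletion KΩ K) (hK : IsPartiallyReproducing KΩ) :
    OperatorFamily D hK := fun s t _ =>
  (restrictMap (hc.windowKernel_eq hK s)).comp
    (K.embed _ (hc.windowKernel_eq hK t)).toContinuousLinearMap

theorem transferFamily_apply (hc : IsCompletion KΩ K) {s t : D.T} (h : t ≤ s)
    (f : (windowKernel D hK t).H) :
    transferFamily hc hK s t h f =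
      restrictMap (hc.windowKernel_eq hK s) (K.embed _ (hc.windowKernel_eq hK t) f) :=
  rfl

theorem inner_transferFamily_gen (hc : IsCompletion KΩ K) {s t : D.T} (h : t ≤ s)
    (x : D.window t) (y : D.window s) :
    ⟪transferFamily hc hK s t h ((windowKernel D hK t).gen x), (windowKernel D hK s).gen y⟫_ℝ =
      K x y := by
  rw [transferFamily_apply, restrictMap_inner_left, embed_gen, embed_gen, inner_gen_gen]

theorem represents_transferFamily (hc : IsCompletion KΩ K) :
    Represents D hK (transferFamily hc hK) K := by
  intro s t x y hx hy
  refine ⟨fun h => (inner_transferFamily_gen hc h ⟨x, hx⟩ ⟨y, hy⟩).symm, fun h => ?_⟩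
  rw [ContinuousLinearMap.adjoint_inner_left, real_inner_comm, inner_transferFamily_gen,
    K.isKernel.1]

/-- The kernel determines the operators. -/
theorem Represents.eq_transferFamily {Φ : OperatorFamily D hK} (hΦ : Represents D hK Φ K)
    (hc : IsCompletion KΩ K) : Φ = transferFamily hc hK := by
  funext s t h
  refine ext_gen fun x => ext_inner_gen fun y => ?_
  rw [inner_transferFamily_gen, ← (hΦ t s x y x.2 y.2).1 h]

/-- The operators determine the kernel. -/
theorem Represents.unique {Φ : OperatorFamily D hK} {K' : ReproducingKernel I}
    (hΦ : Represents D hK Φ K) (hΦ' : Represents D hK Φ K') : K = K' := by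
  have : K.toFun = K'.toFun := by
    funext x y
    rcases le_total (D.tau x) (D.tau y) with h | h
    · exact ((hΦ _ _ x y (D.mem_window_tau x) (D.mem_window_tau y)).1 h).trans
        ((hΦ' _ _ x y (D.mem_window_tau x) (D.mem_window_tau y)).1 h).symm
    · exact ((hΦ _ _ x y (D.mem_window_tau x) (D.mem_window_tau y)).2 h).trans
        ((hΦ' _ _ x y (D.mem_window_tau x) (D.mem_window_tau y)).2 h).symm
  cases K; cases K'; congr

/-- The functoriality of the operators is a Markov property of the kernel. -/
theorem transferFamily_comp_iff (hc : IsCompletion KΩ K) {x y z : D.T} (hyx : y ≤ x)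
    (hzy : z ≤ y) :
    transferFamily hc hK x z (hzy.trans hyx) =
        (transferFamily hc hK x y hyx).comp (transferFamily hc hK y z hzy) ↔
      ∀ u ∈ D.window z, ∀ v ∈ D.window x,
        K u v = ⟪K.proj (D.window y) (K.gen u), K.gen v⟫_ℝ := by
  -- The inner factor `V_y V_y^*` of `V_x^* V_y V_y^* V_z` is the projection for `I_y`.
  have key (u : D.window z) (v : D.window x) :
      ⟪((transferFamily hc hK x y hyx).comp (transferFamily hc hK y z hzy))
        ((windowKernel D hK z).gen u), (windowKernel D hK x).gen v⟫_ℝ =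
      ⟪K.proj (D.window y) (K.gen u), K.gen v⟫_ℝ := by
    rw [ContinuousLinearMap.comp_apply, transferFamily_apply, transferFamily_apply,
      restrictMap_inner_left, embed_gen, embed_gen,
      proj_eq_embed_restrictMap (hc.windowKernel_eq hK y)]
  constructor
  · intro h u hu v hv
    rw [← key ⟨u, hu⟩ ⟨v, hv⟩, ← h, inner_transferFamily_gen]
  · intro h
    refine ext_gen fun u => ext_inner_gen fun v => ?_
    rw [key, inner_transferFamily_gen, h u u.2 v v.2]

theorem isCanonicalSemigroupoid_transferFamily (hcan : IsCanonicalCompletion KΩ K) :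
    IsCanonicalSemigroupoid D hK (transferFamily hcan.1 hK) where
  contraction s t h := by
    refine (ContinuousLinearMap.opNorm_comp_le _ _).trans ?_
    exact mul_le_one₀ (norm_restrictMap_le _) (norm_nonneg _)
      (LinearIsometry.norm_toContinuousLinearMap_le _)
  comp x y z hyx hzy := by
    refine (transferFamily_comp_iff hcan.1 hyx hzy).mpr fun u hu v hv => ?_
    -- Separation concerns only points outside `I_y`; the generator of a point of `I_y` is fixed by
    -- the projection.
    by_cases hu' : u ∈ D.window y
    · rw [proj_gen _ hu', inner_gen_gen]
    by_cases hv' : v ∈ D.window y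
    · rw [inner_proj, proj_gen _ hv', inner_gen_gen]
    refine (isCanonicalCompletion_iff.mp hcan).2 _ _ _ (RegularDomain.separates_window ?_ ?_)
    · by_contra! h
      exact hu' ⟨h, hu.2.trans (D.strictMono_b.monotone hzy)⟩
    · by_contra! h
      exact hv' ⟨(Subtype.coe_le_coe.mpr hyx).trans hv.1, h⟩
  map_gen x y h z hx hy := by
    refine ext_inner_gen fun v => ?_
    rw [inner_transferFamily_gen, inner_gen_gen, hcan.1.windowKernel_eq hK]

end Family
end KernelCompletion
end

/-! ### From semigroupoids to completions -/

noncomputable section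

namespace KernelCompletion

/-- A contraction that preserves the norm of `f` is inverted on `f` by its adjoint. -/
theorem adjoint_apply_of_norm_eq {E F : Type*} [NormedAddCommGroup E] [InnerProductSpace ℝ E]
    [CompleteSpace E] [NormedAddCommGroup F] [InnerProductSpace ℝ F] [CompleteSpace F]
    {A : E →L[ℝ] F} (hA : ‖A‖ ≤ 1) {f : E} (hf : ‖A f‖ = ‖f‖) : A.adjoint (A f) = f := by
  rw [← sub_eq_zero, ← norm_eq_zero, ← sq_eq_zero_iff]
  have h1 : ‖A.adjoint (A f)‖ ≤ ‖f‖ := by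
    refine ((A.adjoint.le_opNorm _).trans ?_)
    rw [LinearIsometryEquiv.norm_map, hf]
    exact mul_le_of_le_one_left (norm_nonneg _) hA
  have h2 : ⟪A.adjoint (A f), f⟫_ℝ = ‖f‖ ^ 2 := by
    rw [ContinuousLinearMap.adjoint_inner_left, real_inner_self_eq_norm_sq, hf]
  -- The square expands to `‖A^* A f‖² - 2‖f‖² + ‖f‖²`, which is at most `0`.
  refine le_antisymm ?_ (sq_nonneg _)
  rw [norm_sub_sq_real, h2]
  nlinarith [norm_nonneg (A.adjoint (A f)), norm_nonneg f]

open ReproducingKernel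

variable {D : RegularDomain} {KΩ : D.edges → ℝ} {hK : IsPartiallyReproducing KΩ}

theorem inner_gen_window (t : D.T) {x y : I} (hx : x ∈ D.window t) (hy : y ∈ D.window t) :
    ⟪(windowKernel D hK t).gen ⟨x, hx⟩, (windowKernel D hK t).gen ⟨y, hy⟩⟫_ℝ =
      KΩ ⟨(x, y), D.window_clique t ⟨hx, hy⟩⟩ := by
  rw [inner_gen_gen]; rfl

theorem norm_gen_window {s t : D.T} {x : I} (hs : x ∈ D.window s) (ht : x ∈ D.window t) :
    ‖(windowKernel D hK s).gen ⟨x, hs⟩‖ = ‖(windowKernel D hK t).gen ⟨x, ht⟩‖ := by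
  rw [← sq_eq_sq₀ (norm_nonneg _) (norm_nonneg _), ← real_inner_self_eq_norm_sq,
    ← real_inner_self_eq_norm_sq, inner_gen_window, inner_gen_window]

namespace IsCanonicalSemigroupoid

variable {Φ : OperatorFamily D hK}

/-- The squared norm of the generator of `x` is `K_Ω(x, x)` in every window containing `x`, so the
contraction preserves its norm and the adjoint inverts it there. -/
theorem adjoint_gen (hΦ : IsCanonicalSemigroupoid D hK Φ) {s t : D.T} (h : s ≤ t) {x : I}
    (hs : x ∈ D.window s) (ht : x ∈ D.window t) :
    (Φ t s h).adjoint ((windowKernel D hK t).gen ⟨x, ht⟩) = (windowKernel D hK s).gen ⟨x, hs⟩ := by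
  rw [← hΦ.map_gen t s h x ht hs]
  refine adjoint_apply_of_norm_eq (hΦ.contraction t s h) ?_
  rw [hΦ.map_gen t s h x ht hs]
  exact norm_gen_window ht hs

theorem apply_gen_eq (hΦ : IsCanonicalSemigroupoid D hK Φ) {r s t : D.T} (hrs : r ≤ s)
    (hst : s ≤ t) {x : I} (hr : x ∈ D.window r) (hs : x ∈ D.window s) :
    Φ t r (hrs.trans hst) ((windowKernel D hK r).gen ⟨x, hr⟩) =
      Φ t s hst ((windowKernel D hK s).gen ⟨x, hs⟩) := by
  rw [hΦ.comp t s r hst hrs, ContinuousLinearMap.comp_apply, hΦ.map_gen]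

end IsCanonicalSemigroupoid

/-- The generator of `x` in the last window that contains `x`. -/
def lastGen (hK : IsPartiallyReproducing KΩ) (x : I) : (windowKernel D hK (D.tau x)).H :=
  (windowKernel D hK (D.tau x)).gen ⟨x, RegularDomain.mem_window_tau x⟩

open Classical in
/-- The image of `lastGen x` in the space of a later window. -/
def push (Φ : OperatorFamily D hK) (u : D.T) (x : I) : (windowKernel D hK u).H :=
  -- The default value `0` plays no role: `push` is only used for `tau x ≤ u`. It spares a proof
  -- argument inside sums.
  if h : D.tau x ≤ u then Φ u (D.tau x) h (lastGen hK x) else 0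

theorem push_eq (Φ : OperatorFamily D hK) {u : D.T} {x : I} (h : D.tau x ≤ u) :
    push Φ u x = Φ u (D.tau x) h (lastGen hK x) := dif_pos h

/-- The kernel defined by a canonical semigroupoid. -/
def familyKernel (Φ : OperatorFamily D hK) (x y : I) : ℝ :=
  if x ≤ y then ⟪push Φ (D.tau y) x, lastGen hK y⟫_ℝ else ⟪push Φ (D.tau x) y, lastGen hK x⟫_ℝ

theorem familyKernel_of_le (Φ : OperatorFamily D hK) {x y : I} (h : x ≤ y) :
    familyKernel Φ x y = ⟪push Φ (D.tau y) x, lastGen hK y⟫_ℝ := if_pos h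

theorem familyKernel_symm (Φ : OperatorFamily D hK) (x y : I) :
    familyKernel Φ x y = familyKernel Φ y x := by
  rcases lt_trichotomy x y with h | rfl | h
  · rw [familyKernel, familyKernel, if_pos h.le, if_neg h.not_ge]
  · rfl
  · rw [familyKernel, familyKernel, if_neg h.not_ge, if_pos h.le]

namespace IsCanonicalSemigroupoid

variable {Φ : OperatorFamily D hK}

theorem push_tau (hΦ : IsCanonicalSemigroupoid D hK Φ) (x : I) :
    push Φ (D.tau x) x = lastGen hK x := by
  rw [push_eq Φ le_rfl]
  exact hΦ.map_gen _ _ _ _ _ _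

theorem push_push (hΦ : IsCanonicalSemigroupoid D hK Φ) {s t : D.T} (h : s ≤ t) {x : I}
    (hx : D.tau x ≤ s) : Φ t s h (push Φ s x) = push Φ t x := by
  rw [push_eq Φ hx, push_eq Φ (hx.trans h), hΦ.comp t s _ h hx, ContinuousLinearMap.comp_apply]

/-- Nonnegativity alone would not carry the induction; the lower bound by a squared norm, in every
later window, does. When the largest point is added, the earlier vectors are pushed to its last
window, where the square is expanded; the contraction to `u` only decreases it. -/
theorem norm_sum_push_sq_le (hΦ : IsCanonicalSemigroupoid D hK Φ) {n : ℕ} (x : Fin n → I)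
    (α : Fin n → ℝ) (s : Finset (Fin n)) :
    ∀ u : D.T, (∀ i ∈ s, D.tau (x i) ≤ u) →
      ‖∑ i ∈ s, α i • push Φ u (x i)‖ ^ 2 ≤
        ∑ i ∈ s, ∑ j ∈ s, α i * α j * familyKernel Φ (x i) (x j) := by
  induction s using Finset.induction_on_max_value x with
  | empty => intro u _; simp
  | insert a s ha hmax ih =>
    intro u hu
    set m := D.tau (x a) with hm
    have hsm : ∀ i ∈ s, D.tau (x i) ≤ m := fun i hi => D.tau_mono (hmax i hi)
    have hmu : m ≤ u := hu a (Finset.mem_insert_self _ _)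
    set w := ∑ i ∈ s, α i • push Φ m (x i) with hw
    have hsum : ∑ i ∈ insert a s, α i • push Φ u (x i) =
        Φ u m hmu (w + α a • lastGen hK (x a)) := by
      rw [Finset.sum_insert ha, map_add, map_smul, hw, map_sum, add_comm]
      congr 1
      · refine Finset.sum_congr rfl fun i hi => ?_
        rw [map_smul, hΦ.push_push hmu (hsm i hi)]
      · rw [push_eq Φ hmu]
    have hcross : ∑ i ∈ s, α i * α a * familyKernel Φ (x i) (x a) =
        α a * ⟪w, lastGen hK (x a)⟫_ℝ := by
      rw [hw, sum_inner, Finset.mul_sum]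
      refine Finset.sum_congr rfl fun i hi => ?_
      rw [familyKernel_of_le Φ (hmax i hi), real_inner_smul_left]
      ring
    have hcross' : ∑ j ∈ s, α a * α j * familyKernel Φ (x a) (x j) =
        α a * ⟪w, lastGen hK (x a)⟫_ℝ := by
      rw [← hcross]
      refine Finset.sum_congr rfl fun i _ => ?_
      rw [familyKernel_symm Φ (x a), mul_comm (α a)]
    have hdiag : familyKernel Φ (x a) (x a) = ‖lastGen hK (x a)‖ ^ 2 := by
      rw [familyKernel_of_le Φ le_rfl, hΦ.push_tau, real_inner_self_eq_norm_sq]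
    have hle : ‖Φ u m hmu (w + α a • lastGen hK (x a))‖ ^ 2 ≤ ‖w + α a • lastGen hK (x a)‖ ^ 2 :=
      pow_le_pow_left₀ (norm_nonneg _)
        ((Φ u m hmu).le_of_opNorm_le (hΦ.contraction u m hmu) _ |>.trans_eq (one_mul _)) 2
    rw [norm_add_sq_real, norm_smul, real_inner_smul_right, mul_pow, Real.norm_eq_abs, sq_abs] at hle
    have := ih m hsm
    simp only [Finset.sum_insert ha, Finset.sum_add_distrib]
    rw [← Finset.sum_insert (f := fun i => α i • push Φ u (x i)) ha, hsum, hcross, hcross', hdiag]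
    linarith

/-- The completion defined by a canonical semigroupoid. -/
def completion (hΦ : IsCanonicalSemigroupoid D hK Φ) : ReproducingKernel I where
  toFun := familyKernel Φ
  isKernel := ⟨familyKernel_symm Φ, fun _ x α => (sq_nonneg _).trans
    (hΦ.norm_sum_push_sq_le x α Finset.univ (D.tau 1) fun _ _ => D.tau_mono (unitInterval.le_one _))⟩

/-- The kernel is defined through last windows only; here the pairing is shown not to depend on the
windows chosen. -/
theorem completion_eq_inner (hΦ : IsCanonicalSemigroupoid D hK Φ) {s t : D.T} (h : s ≤ t) {x y : I}
    (hx : x ∈ D.window s) (hy : y ∈ D.window t) :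
    hΦ.completion x y =
      ⟪Φ t s h ((windowKernel D hK s).gen ⟨x, hx⟩), (windowKernel D hK t).gen ⟨y, hy⟩⟫_ℝ := by
  have hsx : s ≤ D.tau x := RegularDomain.le_tau hx.1
  have hty : t ≤ D.tau y := RegularDomain.le_tau hy.1
  change familyKernel Φ x y = _
  rcases le_total x y with hxy | hxy
  · rw [familyKernel_of_le Φ hxy, push_eq Φ (D.tau_mono hxy), lastGen, lastGen,
      ← hΦ.apply_gen_eq hsx (D.tau_mono hxy) hx, hΦ.comp _ t s hty h,
      ContinuousLinearMap.comp_apply, ← ContinuousLinearMap.adjoint_inner_right,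
      hΦ.adjoint_gen hty hy]
  -- Now `s ≤ t ≤ tau y ≤ tau x`, and `x` lies in the two extreme windows, hence in all those
  -- between. Thus `x` and `y` share windows and both sides reduce to a value of `K_Ω`.
  · have hyx := D.tau_mono hxy
    have hx' := RegularDomain.mem_window_of_mem_of_mem h (hty.trans hyx) hx
      (RegularDomain.mem_window_tau x)
    have hx'' := RegularDomain.mem_window_of_mem_of_mem hty hyx hx'
      (RegularDomain.mem_window_tau x)
    rw [familyKernel_symm, familyKernel_of_le Φ hxy, push_eq Φ hyx, lastGen, lastGen,
      ← ContinuousLinearMap.adjoint_inner_right, hΦ.adjoint_gen hyx hx'', real_inner_comm,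
      hΦ.map_gen t s h x hx' hx, inner_gen_window, inner_gen_window]

theorem represents_completion (hΦ : IsCanonicalSemigroupoid D hK Φ) :
    Represents D hK Φ hΦ.completion := by
  refine fun s t x y hx hy => ⟨fun h => hΦ.completion_eq_inner h hx hy, fun h => ?_⟩
  rw [ContinuousLinearMap.adjoint_inner_left, real_inner_comm, ← hΦ.completion_eq_inner h hy hx,
    hΦ.completion.isKernel.1]

theorem isCompletion_of_represents (hΦ : IsCanonicalSemigroupoid D hK Φ)
    {K : ReproducingKernel I} (h : Represents D hK Φ K) : IsCompletion KΩ K := by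
  rintro ⟨⟨x, y⟩, hp⟩
  obtain ⟨t, hx, hy⟩ := mem_iUnion.mp hp
  rw [(h t t x y hx hy).1 le_rfl, hΦ.map_gen t t le_rfl x hx hx, inner_gen_window]

end IsCanonicalSemigroupoid
end KernelCompletion
end

/-! ### From windows to arbitrary separating sets -/

noncomputable section

namespace KernelCompletion

open ReproducingKernel

/-- A separating set contains the interior of a window between the separated points. -/
theorem Separates.exists_window {D : RegularDomain} {S : Set I} {x y : I}
    (h : Separates D.edges S x y) (hxy : x < y) :
    ∃ r : D.T, (x : ℝ) ≤ r ∧ D.b r ≤ y ∧ ∀ u : I, (r : ℝ) < u → (u : ℝ) < D.b r → u ∈ S := by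
  obtain ⟨hxS, hyS, hsep⟩ := h
  -- The points up to `y` that are reachable from `x` by paths avoiding `S`. The window sought
  -- starts at `r = sup R`.
  let R : Set I := {z | z ≤ y ∧ ∃ (n : ℕ) (p : ℕ → I), p 0 = x ∧ p n = z ∧
    (∀ k < n, (p k, p (k + 1)) ∈ D.edges) ∧ ∀ k ≤ n, p k ∉ S}
  have hyR : y ∉ R := by
    rintro ⟨-, n, p, h0, hn, hp, hpS⟩
    rcases n with _ | n
    · exact hxy.ne (h0.symm.trans hn)
    · obtain ⟨k, -, hk, hkS⟩ := hsep n p h0 hn fun k hk => hp k (by omega)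
      exact hpS k (by omega) hkS
  have hstep : ∀ z ∈ R, ∀ u, z ≤ u → u ≤ y → (u : ℝ) ≤ D.b (D.tau z) → u ∉ S → u ∈ R := by
    rintro z ⟨-, n, p, h0, hn, hp, hpS⟩ u hzu huy hub huS
    refine ⟨huy, n + 1, fun k => if k ≤ n then p k else u, by simp [h0], by simp, fun k hk => ?_,
      fun k hk => ?_⟩
    · rcases Nat.lt_succ_iff_lt_or_eq.mp hk with hk | rfl
      · simpa [hk.le, Nat.succ_le_of_lt hk] using hp k hk
      · simpa [hn] using RegularDomain.mem_edges_of_le hzu hub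
    · by_cases hkn : k ≤ n
      · simpa [hkn] using hpS k hkn
      · simpa [hkn] using huS
  have hlt : ∀ z ∈ R, D.b (D.tau z) < y := fun z hz => by
    by_contra! hle
    exact hyR (hstep z hz y hz.1 le_rfl hle hyS)
  -- Beyond `t₀` the last window ends at `1`, so `y` would be reachable in one more step. Hence the
  -- supremum is a parameter in `T`.
  have hRt : ∀ z ∈ R, (z : ℝ) ≤ D.t₀ := fun z hz => by
    by_contra! hle
    have := hlt z hz
    rw [RegularDomain.b_tau_of_le hle.le] at this
    exact this.not_ge y.2.2
  have hxR : x ∈ R := ⟨hxy.le, 0, fun _ => x, rfl, rfl, by simp, fun _ _ => hxS⟩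
  let R' : Set ℝ := (fun z : I => (z : ℝ)) '' R
  have hne : R'.Nonempty := ⟨x, x, hxR, rfl⟩
  have hbdd : BddAbove R' := ⟨D.t₀, by rintro _ ⟨z, hz, rfl⟩; exact hRt z hz⟩
  have hle : ∀ z ∈ R, (z : ℝ) ≤ sSup R' := fun z hz => le_csSup hbdd ⟨z, hz, rfl⟩
  let r : D.T := ⟨sSup R', x.2.1.trans (hle x hxR),
    csSup_le hne (by rintro _ ⟨z, hz, rfl⟩; exact hRt z hz)⟩
  -- The supremum need not be attained; left-continuity of `b` lets points of `R` near `r` reach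
  -- almost as far as `b(r)`.
  have happrox : ∀ c < D.b r, ∃ z ∈ R, c < D.b (D.tau z) := by
    intro c hc
    have hev := (D.leftContinuous_b r).eventually (lt_mem_nhds hc)
    obtain ⟨ε, hε, hball⟩ := Metric.mem_nhdsWithin_iff.mp hev
    obtain ⟨_, ⟨z, hz, rfl⟩, hzr⟩ := exists_lt_of_lt_csSup hne (sub_lt_self (sSup R') hε)
    refine ⟨z, hz, hball ⟨?_, ?_⟩⟩
    · have ht : (D.tau z : ℝ) = z := min_eq_left (hRt z hz)
      rw [Metric.mem_ball, Subtype.dist_eq, ht, Real.dist_eq, abs_lt]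
      have := hle z hz
      exact ⟨by linarith, by linarith⟩
    · exact Subtype.coe_le_coe.mp (show (D.tau z : ℝ) ≤ r from (min_le_left _ _).trans (hle z hz))
  have hby : D.b r ≤ y := by
    by_contra! hc
    obtain ⟨z, hz, hyz⟩ := happrox _ hc
    exact (hlt z hz).not_gt hyz
  refine ⟨r, hle x hxR, hby, fun u hru hub => ?_⟩
  by_contra huS
  obtain ⟨z, hz, huz⟩ := happrox _ hub
  have hzu : z ≤ u := Subtype.coe_le_coe.mp ((hle z hz).trans hru.le)
  -- A point of `(r, b(r))` outside `S` would be reachable from `z`, although it exceeds the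
  -- supremum.
  exact (hle u (hstep z hz u hzu (Subtype.coe_le_coe.mp (hub.le.trans hby)) huz.le huS)).not_gt hru

namespace ReproducingKernel

universe u

variable {X : Type u}

theorem norm_gen_sub_gen (K : ReproducingKernel X) (x y : X) :
    ‖K.gen x - K.gen y‖ = √(K x x - 2 * K x y + K y y) := by
  rw [← inner_gen_gen, ← inner_gen_gen, ← inner_gen_gen, real_inner_self_eq_norm_sq,
    real_inner_self_eq_norm_sq, ← norm_sub_sq_real, Real.sqrt_sq (norm_nonneg _)]

/-- Projections to spans of generators commute if one of them preserves the other span. -/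
theorem proj_comm_of_mem {K : ReproducingKernel X} {A S : Set X}
    (h : ∀ x ∈ S, K.proj A (K.gen x) ∈ K.closedSpan S) (a : K.H) :
    K.proj S (K.proj A a) = K.proj A (K.proj S a) := by
  refine eq_proj ?_ fun x hx => ?_
  · have hc : IsClosed ((K.closedSpan S).comap (K.proj A).toLinearMap : Set K.H) :=
      (K.isClosed_closedSpan S).preimage (K.proj A).continuous
    exact closedSpan_le hc h (K.proj_mem S a)
  · rw [inner_proj, inner_proj, inner_proj, K.proj_of_mem (h x hx)]

end ReproducingKernel

variable {D : RegularDomain} {KΩ : D.edges → ℝ} {K : ReproducingKernel I}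

/-- The generators of a completion depend continuously on a point of a window. -/
theorem IsCompletion.continuousOn_gen (hc : IsCompletion KΩ K) (hcont : Continuous KΩ) (t : D.T) :
    ContinuousOn K.gen (D.window t) := by
  rw [continuousOn_iff_continuous_domRestrict, continuous_iff_continuousAt]
  intro u
  rw [ContinuousAt, tendsto_iff_norm_sub_tendsto_zero]
  have hK : ∀ v w : D.window t, K v w = KΩ ⟨((v : I), (w : I)), D.window_clique t ⟨v.2, w.2⟩⟩ :=
    fun v w => hc ⟨((v : I), (w : I)), D.window_clique t ⟨v.2, w.2⟩⟩
  -- The squared distance is `K(v, v) - 2 K(v, u) + K(u, u)`, which involves values on `I_t × I_t`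
  -- only, where `K` equals the continuous `K_Ω`.
  have hF : Continuous fun v : D.window t => ‖K.gen v - K.gen u‖ := by
    simp only [norm_gen_sub_gen, hK]
    refine Continuous.sqrt (((hcont.comp ?_).sub (continuous_const.mul (hcont.comp ?_))).add
      continuous_const) <;>
    · refine Continuous.subtype_mk ?_ _
      fun_prop
  simpa using! hF.tendsto u

theorem RegularDomain.window_subset_closure (D : RegularDomain) (t : D.T) :
    D.window t ⊆ closure {u : I | (t : ℝ) < u ∧ (u : ℝ) < D.b t} := by
  intro u hu
  rw [closure_subtype]
  have : ((↑) : I → ℝ) '' {u : I | (t : ℝ) < u ∧ (u : ℝ) < D.b t} = Ioo (t : ℝ) (D.b t) := by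
    ext v
    constructor
    · rintro ⟨w, hw, rfl⟩
      exact hw
    · intro hv
      exact ⟨⟨v, t.2.1.trans hv.1.le, hv.2.le.trans (D.b_le_one t)⟩, hv, rfl⟩
  rw [this, closure_Ioo (D.lt_b t).ne]
  exact hu

/-- The set `S` may miss the end points of the window. They are limits of interior points, and their
generators are recovered by continuity of `K_Ω`. -/
theorem IsCompletion.gen_mem_closedSpan_of_window (hc : IsCompletion KΩ K)
    (hcont : Continuous KΩ) {t : D.T} {S : Set I}
    (hS : ∀ u : I, (t : ℝ) < u → (u : ℝ) < D.b t → u ∈ S) {u : I} (hu : u ∈ D.window t) :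
    K.gen u ∈ K.closedSpan S := by
  have h1 : ContinuousWithinAt K.gen {u : I | (t : ℝ) < u ∧ (u : ℝ) < D.b t} u :=
    ((hc.continuousOn_gen hcont t) u hu).mono fun v hv => ⟨hv.1.le, hv.2.le⟩
  have h2 := h1.mem_closure (D.window_subset_closure t hu) (t := (K.closedSpan S : Set K.H))
    fun v hv => K.gen_mem_closedSpan (hS v hv.1 hv.2)
  rwa [(K.isClosed_closedSpan S).closure_eq] at h2

/-- A completion that has the Markov property with respect to all windows is canonical. -/
theorem IsCompletion.isCanonicalCompletion (hc : IsCompletion KΩ K) (hcont : Continuous KΩ)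
    (hM : ∀ (r : D.T) (x y : I), (x : ℝ) ≤ D.b r → (r : ℝ) ≤ y →
      K x y = ⟪K.proj (D.window r) (K.gen x), K.gen y⟫_ℝ) : IsCanonicalCompletion KΩ K := by
  have main (S : Set I) (x y : I) (h : Separates D.edges S x y) (hxy : x < y) :
      K x y = ⟪K.proj S (K.gen x), K.gen y⟫_ℝ := by
    obtain ⟨r, hxr, hry, hrS⟩ := h.exists_window hxy
    have hwin : K.closedSpan (D.window r) ≤ K.closedSpan S :=
      closedSpan_le (K.isClosed_closedSpan S) fun u hu =>
        hc.gen_mem_closedSpan_of_window hcont hrS hu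
    -- The past of the window `I_r`. By the Markov property, the projection of a generator from `[r,
    -- 1]` onto this past already lies in the span of `I_r`.
    let A : Set I := {u | (u : ℝ) ≤ D.b r}
    have hproj : ∀ u : I, (r : ℝ) ≤ u → K.proj A (K.gen u) = K.proj (D.window r) (K.gen u) := by
      intro u hu
      refine eq_proj ?_ fun w hw => ?_
      · exact closedSpan_le (K.isClosed_closedSpan A) (fun v hv => K.gen_mem_closedSpan hv.2)
          (K.proj_mem _ _)
      · rw [inner_proj, real_inner_comm, ← hM r w u hw hu, inner_gen_gen, K.isKernel.1]
    have hA : ∀ u ∈ S, K.proj A (K.gen u) ∈ K.closedSpan S := by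
      intro u hu
      rcases le_total (u : ℝ) (D.b r) with hub | hub
      · rw [K.proj_gen (A := A) hub]
        exact K.gen_mem_closedSpan hu
      · rw [hproj u ((D.lt_b r).le.trans hub)]
        exact hwin (K.proj_mem _ _)
    have hxb : (x : ℝ) ≤ D.b r := hxr.trans (D.lt_b r).le
    have hyr : (r : ℝ) ≤ y := (D.lt_b r).le.trans hry
    calc K x y = ⟪K.proj (D.window r) (K.gen x), K.gen y⟫_ℝ := hM r x y hxb hyr
      _ = ⟪K.gen x, K.proj S (K.proj (D.window r) (K.gen y))⟫_ℝ := by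
        rw [K.proj_of_mem (hwin (K.proj_mem _ _)), inner_proj]
      _ = ⟪K.proj A (K.proj S (K.gen x)), K.gen y⟫_ℝ := by
        rw [← inner_proj, ← hproj y hyr, inner_proj K A]
      _ = ⟪K.proj S (K.gen x), K.gen y⟫_ℝ := by
        rw [← proj_comm_of_mem hA, K.proj_gen (A := A) hxb]
  refine isCanonicalCompletion_iff.mpr ⟨hc, fun S x y h => ?_⟩
  rcases lt_trichotomy x y with hxy | rfl | hxy
  · exact main S x y h hxy
  -- No set separates a point from itself: the path consisting of the loop at `x` has no interior
  -- vertex.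
  · obtain ⟨k, h1, h2, -⟩ := h.2.2 0 (fun _ => x) rfl rfl fun _ _ =>
      D.window_clique (D.tau x) ⟨D.mem_window_tau x, D.mem_window_tau x⟩
    omega
  · rw [inner_proj, real_inner_comm, ← main S y x h.symm hxy, K.isKernel.1]

end KernelCompletion
end

/-! ### Canonicity of the constructed completion and the bijection -/

noncomputable section

namespace KernelCompletion

open ReproducingKernel

variable {D : RegularDomain} {KΩ : D.edges → ℝ} {hK : IsPartiallyReproducing KΩ}

/-- The Markov property at `I_r` is trivial if `x ∈ I_r`. Otherwise `tau x ≤ r ≤ tau y`, and it is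
the composition law for these three parameters. -/
theorem IsCanonicalSemigroupoid.isCanonicalCompletion {Φ : OperatorFamily D hK}
    (hΦ : IsCanonicalSemigroupoid D hK Φ) (hcont : Continuous KΩ) :
    IsCanonicalCompletion KΩ hΦ.completion := by
  have hc := hΦ.isCompletion_of_represents hΦ.represents_completion
  have hΦK := hΦ.represents_completion.eq_transferFamily hc
  refine hc.isCanonicalCompletion hcont fun r x y hx hy => ?_
  by_cases hxr : x ∈ D.window r
  · rw [proj_gen _ hxr, inner_gen_gen]
  have hxr' : D.tau x ≤ r := by
    by_contra! hlt
    exact hxr ⟨(Subtype.coe_le_coe.mpr hlt.le).trans (D.tau_le x), hx⟩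
  refine (transferFamily_comp_iff (hK := hK) hc (D.le_tau hy) hxr').mp ?_ x (D.mem_window_tau x) y
    (D.mem_window_tau y)
  rw [← hΦK]
  exact hΦ.comp _ _ _ _ _

end KernelCompletion
end

theorem mainTheorem8 (D : KernelCompletion.RegularDomain) (KΩ : D.edges → ℝ)
    (hcont : Continuous KΩ) (hK : KernelCompletion.IsPartiallyReproducing KΩ) :
    ∃ e : {K : KernelCompletion.ReproducingKernel unitInterval //
            KernelCompletion.IsCanonicalCompletion KΩ K} ≃
          {Φ : KernelCompletion.OperatorFamily D hK //
            KernelCompletion.IsCanonicalSemigroupoid D hK Φ},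
      ∀ K Φ, e K = Φ ↔ KernelCompletion.Represents D hK Φ.1 K.1 := by
  refine ⟨{
    toFun := fun K => ⟨KernelCompletion.transferFamily K.2.1 hK,
      KernelCompletion.isCanonicalSemigroupoid_transferFamily K.2⟩
    invFun := fun Φ => ⟨Φ.2.completion, Φ.2.isCanonicalCompletion hcont⟩
    left_inv := fun K => Subtype.ext
      ((KernelCompletion.isCanonicalSemigroupoid_transferFamily K.2).represents_completion.unique
        (KernelCompletion.represents_transferFamily K.2.1))
    right_inv := fun Φ => Subtype.ext (Φ.2.represents_completion.eq_transferFamily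
      (Φ.2.isCanonicalCompletion hcont).1).symm },
    fun K Φ => ⟨?_, fun h => Subtype.ext (h.eq_transferFamily K.2.1).symm⟩⟩
  rintro rfl
  exact KernelCompletion.represents_transferFamily K.2.1
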